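/- For $a\in\mathbb{C}$ with $\Re(a)>0$ let $\zeta(\sigma,a)=\sum_{k\ge 0}(k+a)^{-\sigma}$ ($\Re(\sigma)>1$, principal branch) be the Hurwitz zeta function, and let $\zeta^{(r,0)}(j,a)$ denote its $r$-th derivative with respect to $\sigma$ at $\sigma=j$. Let $s(n,k)$ be the signed Stirling numbers of the first kind, defined by $x(x+1)\cdots(x+n-1)=\sum_{k=0}^n(-1)^{n-k}s(n,k)x^k$. For integers $\ell,m,n\ge 0$ with $m+n\ge 1$ put $$R_{\ell,m,n,a}=\frac{(-1)^{m+1}}{(m+n)!}\sum_{k=0}^{\ell}s(m+n+1,k+1)\,\frac{\ell!}{(\ell-k)!}\,(-1)^k\int_0^1x^m(1-x)^n\,\zeta^{(\ell-k,0)}(m+n+1,a+x)\,dx .$$ Let $\ell\ge 0$ be an integer and let $a\in\mathbb{C}$ with $\Re(a)\ge 1$. Then 1. for every fixed integer $n\ge 0$, $\lim_{m\to\infty}R_{\ell,m,n,a}=0$; 2. for every fixed integer $m\ge 0$, $\lim_{n\to\infty}R_{\ell,m,n,a}=0$; 3. for every fixed integer $n\ge 0$, $\limsup_{m\to\infty}|R_{\ell,m,n,a}|^{1/m}\le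 \dfrac{1}{\Re(a)+1}$; 4. if moreover $\Re(a)>1$, then for every fixed integer $m\ge 0$, $\limsup_{n\to\infty}|R_{\ell,m,n,a}|^{1/n}\le \dfrac{1}{\Re(a)}$. -/

import Mathlib

open Filter Topology

/-- The Hurwitz zeta function `ζ(σ, a) = ∑_{k ≥ 0} (k + a)^{-σ}`, for complex `a` with positive
real part and `Re σ > 1` (principal branch of the power). -/
noncomputable def hurwitzZetaSeries (σ a : ℂ) : ℂ :=
  ∑' k : ℕ, 1 / ((k : ℂ) + a) ^ σ

/-- `ζ^{(r,0)}(j, a)`: the `r`-th derivative of `σ ↦ ζ(σ, a)`, evaluated at `σ = j`. It depends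
only on the values of `ζ(·, a)` near `j`, and it is used for integers `j ≥ 2`. -/
noncomputable def hurwitzZetaDeriv (r j : ℕ) (a : ℂ) : ℂ :=
  iteratedDeriv r (fun σ : ℂ => hurwitzZetaSeries σ a) (j : ℂ)

/-- The (signed) Stirling numbers of the first kind. -/
def stirlingS (n k : ℕ) : ℤ :=
  (-1) ^ (n + k) * (Nat.stirlingFirst n k : ℤ)

/-- The defining relation `(x)_n = ∑_{k=0}^{n} (-1)^{n-k} s(n,k) x^k`, where
`(x)_n = x (x+1) ⋯ (x+n-1)`. -/
theorem ascPochhammer_eval_eq_sum_stirlingS (n : ℕ) (x : ℤ) :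
    (ascPochhammer ℤ n).eval x =
      ∑ k ∈ Finset.range (n + 1), (-1) ^ (n - k) * stirlingS n k * x ^ k := by
  have key : (ascPochhammer ℤ n).eval x =
      ∑ k ∈ Finset.range (n + 1), (Nat.stirlingFirst n k : ℤ) * x ^ k := by
    induction n with
    | zero => simp
    | succ n ih =>
      rw [ascPochhammer_succ_eval, ih, Finset.sum_range_succ' _ (n + 1)]
      have h1 : ∀ k, (Nat.stirlingFirst (n + 1) (k + 1) : ℤ) * x ^ (k + 1) =
          (n : ℤ) * ((Nat.stirlingFirst n (k + 1) : ℤ) * x ^ (k + 1)) +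
            x * ((Nat.stirlingFirst n k : ℤ) * x ^ k) := by
        intro k
        rw [Nat.stirlingFirst_succ_succ]
        push_cast
        ring
      simp only [h1, Finset.sum_add_distrib, ← Finset.mul_sum]
      have h2 := Finset.sum_range_succ' (fun k => (Nat.stirlingFirst n k : ℤ) * x ^ k) (n + 1)
      rw [Finset.sum_range_succ, Nat.stirlingFirst_eq_zero_of_lt (Nat.lt_succ_self n)] at h2
      have h3 : (n : ℤ) * (Nat.stirlingFirst n 0 : ℤ) = 0 := by
        cases n <;> simp
      simp only [pow_zero, mul_one, Nat.cast_zero, zero_mul, add_zero] at h2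
      rw [Nat.stirlingFirst_succ_zero]
      push_cast
      linear_combination (n : ℤ) * h2 + h3
  rw [key]
  refine Finset.sum_congr rfl fun k hk => ?_
  have hk' : k ≤ n := Nat.lt_succ_iff.mp (Finset.mem_range.mp hk)
  obtain ⟨d, rfl⟩ := Nat.exists_eq_add_of_le hk'
  have : ((-1 : ℤ)) ^ (k + d - k) * (-1) ^ (k + d + k) = 1 := by
    rw [← pow_add, show k + d - k + (k + d + k) = 2 * (k + d) by omega, pow_mul]
    simp
  rw [stirlingS, ← mul_assoc, this, one_mul]

/-- The remainder
`R_{ℓ,m,n,a} = (-1)^{m+1}/(m+n)! * ∑_{k=0}^{ℓ} s(m+n+1,k+1) (ℓ!/(ℓ-k)!) (-1)^k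
  ∫_0^1 x^m (1-x)^n ζ^{(ℓ-k,0)}(m+n+1, a+x) dx`. -/
noncomputable def stieltjesRemainder (ℓ m n : ℕ) (a : ℂ) : ℂ :=
  (-1) ^ (m + 1) / ((m + n).factorial : ℂ) *
    ∑ k ∈ Finset.range (ℓ + 1),
      (stirlingS (m + n + 1) (k + 1) : ℂ) *
        ((ℓ.factorial : ℂ) / ((ℓ - k).factorial : ℂ)) * (-1) ^ k *
        ∫ x in (0 : ℝ)..1,
          (x : ℂ) ^ m * (1 - (x : ℂ)) ^ n * hurwitzZetaDeriv (ℓ - k) (m + n + 1) (a + (x : ℂ))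

/-!
The `N`-dependence of each factor of the remainder, `N = m + n`, is elementary once the derivatives
of the Hurwitz zeta function are bounded without differentiating the series: for `Re z ≥ 1`,
Cauchy's estimate on the circle `|σ - (N + 1)| = 1` gives
`|ζ^{(r,0)}(N + 1, z)| ≤ r! e^π (∑ 1 / (k + 1)²) (Re z)^{2 - N}` (`norm_hurwitzZetaDeriv_le`).
The Stirling numbers satisfy `|s(N + 1, k + 1)| ≤ N! H_N ^ k` with `H_N` the harmonic number
(`stirlingFirst_succ_succ_le_harmonic`), so that the factor `1 / N!` is compensated up to a power
of `log N`. Writing `b = Re a`, the remainder is therefore at most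
`C (2 + log N)^ℓ ∫₀¹ (x / (b + x))^m ((1 - x) / (b + x))^n dx`
(`exists_norm_stieltjesRemainder_le`).

On `[0, 1]` one has `x / (b + x) ≤ 1 / (b + 1)`, which gives geometric decay in `m`, and
`(1 - x) / (b + x) ≤ (1 - x) / b`, which gives `b^{-n} / (n + 1)` after integration. Since
`(2 + log N)^ℓ = o(N)`, the latter tends to zero even for `b = 1`.
-/

/-! ### Stirling numbers -/

theorem stirlingFirst_succ_succ_le_harmonic (N k : ℕ) :
    (Nat.stirlingFirst (N + 1) (k + 1) : ℝ) ≤ N.factorial * ((harmonic N : ℚ) : ℝ) ^ k := by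
  induction N generalizing k with
  | zero =>
    cases k with
    | zero => simp [Nat.stirlingFirst_self]
    | succ k => simp [Nat.stirlingFirst_eq_zero_of_lt (show 1 < k + 1 + 1 by omega)]
  | succ N ih =>
    have hN : (0 : ℝ) < (N : ℝ) + 1 := by positivity
    have hH : (0 : ℝ) ≤ ((harmonic N : ℚ) : ℝ) := by
      exact_mod_cast Finset.sum_nonneg fun i _ => by positivity
    have hs : ((harmonic (N + 1) : ℚ) : ℝ) = (harmonic N : ℚ) + ((N : ℝ) + 1)⁻¹ := by
      rw [harmonic_succ]; push_cast; rfl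
    have hle : ((harmonic N : ℚ) : ℝ) ≤ (harmonic (N + 1) : ℚ) := by
      rw [hs]; linarith [inv_pos.mpr hN]
    rw [Nat.stirlingFirst_succ_succ, Nat.factorial_succ]
    push_cast
    cases k with
    | zero =>
      have := ih 0
      simp only [pow_zero, mul_one, Nat.stirlingFirst_succ_zero, Nat.cast_zero, add_zero] at this ⊢
      gcongr
    | succ k =>
      calc ((N : ℝ) + 1) * Nat.stirlingFirst (N + 1) (k + 1 + 1) + Nat.stirlingFirst (N + 1) (k + 1)
          ≤ ((N : ℝ) + 1) * (N.factorial * ((harmonic N : ℚ) : ℝ) ^ (k + 1)) +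
              N.factorial * ((harmonic N : ℚ) : ℝ) ^ k := by gcongr <;> apply ih
        _ = ((N : ℝ) + 1) * N.factorial *
              (((harmonic N : ℚ) : ℝ) ^ k * ((harmonic (N + 1) : ℚ) : ℝ)) := by
            rw [hs]; field_simp; ring
        _ ≤ ((N : ℝ) + 1) * N.factorial *
              (((harmonic (N + 1) : ℚ) : ℝ) ^ k * ((harmonic (N + 1) : ℚ) : ℝ)) := by
            have := hH.trans hle
            gcongr
        _ = _ := by ring

theorem norm_stirlingS_succ_succ_le {N k ℓ : ℕ} (hk : k ≤ ℓ) :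
    ‖(stirlingS (N + 1) (k + 1) : ℂ)‖ ≤ N.factorial * (2 + Real.log N) ^ ℓ := by
  have hlog : 0 ≤ Real.log N := Real.log_natCast_nonneg N
  have hH : (0 : ℝ) ≤ ((harmonic N : ℚ) : ℝ) := by
    exact_mod_cast Finset.sum_nonneg fun i _ => by positivity
  have h1 : ((harmonic N : ℚ) : ℝ) ≤ 2 + Real.log N := by
    linarith [harmonic_le_one_add_log N]
  calc ‖(stirlingS (N + 1) (k + 1) : ℂ)‖ = (Nat.stirlingFirst (N + 1) (k + 1) : ℝ) := by
        simp [stirlingS]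
    _ ≤ N.factorial * ((harmonic N : ℚ) : ℝ) ^ k := stirlingFirst_succ_succ_le_harmonic N k
    _ ≤ N.factorial * (2 + Real.log N) ^ k := by gcongr
    _ ≤ N.factorial * (2 + Real.log N) ^ ℓ := by
        gcongr
        linarith

/-! ### Derivatives of the Hurwitz zeta function -/

theorem norm_one_div_cpow_le {z : ℂ} (hz : z ≠ 0) (s : ℂ) :
    ‖1 / z ^ s‖ ≤ Real.exp (Real.pi * |s.im|) * (‖z‖ ^ s.re)⁻¹ := by
  rw [norm_div, norm_one, Complex.norm_cpow_of_ne_zero hz, one_div_div, div_eq_mul_inv]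
  refine mul_le_mul_of_nonneg_right (Real.exp_le_exp.mpr ?_) (by positivity)
  calc z.arg * s.im ≤ |z.arg * s.im| := le_abs_self _
    _ = |z.arg| * |s.im| := abs_mul _ _
    _ ≤ _ := by gcongr; exact Complex.abs_arg_le_pi z

theorem re_le_norm_natCast_add {z : ℂ} (k : ℕ) : k + z.re ≤ ‖(k : ℂ) + z‖ := by
  simpa using Complex.re_le_norm ((k : ℂ) + z)

theorem norm_hurwitzZetaSeries_term_le {z σ : ℂ} (hz : 1 ≤ z.re) {N : ℕ} (hN : 2 ≤ N) {M : ℝ}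
    (hre : N ≤ σ.re) (him : |σ.im| ≤ M) (k : ℕ) :
    ‖1 / ((k : ℂ) + z) ^ σ‖ ≤
      Real.exp (Real.pi * M) * (z.re ^ (N - 2))⁻¹ * (((k : ℝ) + 1) ^ 2)⁻¹ := by
  have hn := re_le_norm_natCast_add (z := z) k
  have hk : (0 : ℝ) ≤ k := k.cast_nonneg
  have h0 : (k : ℂ) + z ≠ 0 := norm_pos_iff.mp (by linarith)
  have hpow : z.re ^ (N - 2) * ((k : ℝ) + 1) ^ 2 ≤ ‖(k : ℂ) + z‖ ^ σ.re :=
    calc z.re ^ (N - 2) * ((k : ℝ) + 1) ^ 2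
        ≤ ‖(k : ℂ) + z‖ ^ (N - 2) * ‖(k : ℂ) + z‖ ^ 2 := by
          gcongr <;> linarith
      _ = ‖(k : ℂ) + z‖ ^ (N : ℝ) := by
          rw [← pow_add, Nat.sub_add_cancel hN, Real.rpow_natCast]
      _ ≤ ‖(k : ℂ) + z‖ ^ σ.re := Real.rpow_le_rpow_of_exponent_le (by linarith) hre
  have hpi := Real.pi_pos
  calc ‖1 / ((k : ℂ) + z) ^ σ‖
      ≤ Real.exp (Real.pi * |σ.im|) * (‖(k : ℂ) + z‖ ^ σ.re)⁻¹ := norm_one_div_cpow_le h0 σ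
    _ ≤ Real.exp (Real.pi * M) * (z.re ^ (N - 2) * ((k : ℝ) + 1) ^ 2)⁻¹ := by
        gcongr
    _ = _ := by rw [mul_inv, mul_assoc]

theorem summable_inv_natCast_add_one_sq : Summable fun k : ℕ => (((k : ℝ) + 1) ^ 2)⁻¹ := by
  simpa using (summable_nat_add_iff 1).mpr (Real.summable_nat_pow_inv.mpr one_lt_two)

theorem norm_hurwitzZetaSeries_le {z σ : ℂ} (hz : 1 ≤ z.re) {N : ℕ} (hN : 2 ≤ N) {M : ℝ}
    (hre : N ≤ σ.re) (him : |σ.im| ≤ M) :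
    ‖hurwitzZetaSeries σ z‖ ≤
      Real.exp (Real.pi * M) * (z.re ^ (N - 2))⁻¹ * ∑' k : ℕ, (((k : ℝ) + 1) ^ 2)⁻¹ := by
  rw [← tsum_mul_left]
  exact tsum_of_norm_bounded (summable_inv_natCast_add_one_sq.mul_left _).hasSum
    (norm_hurwitzZetaSeries_term_le hz hN hre him)

theorem differentiableOn_hurwitzZetaSeries {z : ℂ} (hz : 1 ≤ z.re) {N : ℕ} (hN : 3 ≤ N) :
    DifferentiableOn ℂ (fun σ => hurwitzZetaSeries σ z)
      (Metric.ball ((N + 1 : ℕ) : ℂ) 2) := by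
  refine Complex.differentiableOn_tsum_of_summable_norm
    (u := fun k : ℕ => Real.exp (Real.pi * 2) * (z.re ^ (2 - 2))⁻¹ * (((k : ℝ) + 1) ^ 2)⁻¹)
    (summable_inv_natCast_add_one_sq.mul_left _) (fun k => ?_) Metric.isOpen_ball
    fun k σ hσ => ?_
  · have h0 : (k : ℂ) + z ≠ 0 := by
      refine norm_pos_iff.mp ?_
      have := re_le_norm_natCast_add (z := z) k
      have hk : (0 : ℝ) ≤ k := k.cast_nonneg
      linarith
    intro σ _
    have hd : DifferentiableAt ℂ (fun σ : ℂ => ((k : ℂ) + z) ^ σ) σ :=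
      differentiableAt_id.const_cpow (Or.inl h0)
    exact ((differentiableAt_const 1).div hd (by simp [Complex.cpow_eq_zero_iff, h0])
      ).differentiableWithinAt
  · rw [Metric.mem_ball, dist_eq_norm] at hσ
    have hre := (Complex.abs_re_le_norm _).trans hσ.le
    have him := (Complex.abs_im_le_norm _).trans hσ.le
    simp only [Complex.sub_re, Complex.sub_im, Complex.natCast_re, Complex.natCast_im,
      sub_zero] at hre him
    refine norm_hurwitzZetaSeries_term_le hz le_rfl ?_ him k
    have hN' : (3 : ℝ) ≤ N := by exact_mod_cast hN
    push_cast at hre ⊢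
    linarith [(abs_le.mp hre).1]

/-- Cauchy's estimate on the unit circle around `N + 1`: moving the exponent by at most `1` costs
only a bounded factor, so no logarithms of `k + z` have to be estimated. -/
theorem norm_hurwitzZetaDeriv_le {z : ℂ} (hz : 1 ≤ z.re) (r : ℕ) {N : ℕ} (hN : 3 ≤ N) :
    ‖hurwitzZetaDeriv r (N + 1) z‖ ≤
      r.factorial * (Real.exp Real.pi * (z.re ^ (N - 2))⁻¹ *
        ∑' k : ℕ, (((k : ℝ) + 1) ^ 2)⁻¹) := by
  have hd : DiffContOnCl ℂ (fun σ => hurwitzZetaSeries σ z)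
      (Metric.ball ((N + 1 : ℕ) : ℂ) 1) := by
    refine DifferentiableOn.diffContOnCl ?_
    rw [closure_ball _ one_ne_zero]
    exact (differentiableOn_hurwitzZetaSeries hz hN).mono
      (Metric.closedBall_subset_ball one_lt_two)
  have h := Complex.norm_iteratedDeriv_le_of_forall_mem_sphere_norm_le r one_pos hd
    (C := Real.exp Real.pi * (z.re ^ (N - 2))⁻¹ * ∑' k : ℕ, (((k : ℝ) + 1) ^ 2)⁻¹) ?_
  · simpa [hurwitzZetaDeriv] using h
  · intro σ hσ
    rw [mem_sphere_iff_norm] at hσ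
    have hre := (Complex.abs_re_le_norm _).trans hσ.le
    have him := (Complex.abs_im_le_norm _).trans hσ.le
    simp only [Complex.sub_re, Complex.sub_im, Complex.natCast_re, Complex.natCast_im,
      sub_zero] at hre him
    have := norm_hurwitzZetaSeries_le hz (show 2 ≤ N by omega) (σ := σ) (M := 1) ?_ him
    · simpa using this
    · push_cast at hre
      linarith [(abs_le.mp hre).1]

/-! ### The remainder -/

/-- Every bound `g` for `(x / (b + x)) ^ m ((1 - x) / (b + x)) ^ n`, `b = Re a`, yields a bound for
the remainder, up to a constant and a power of `log (m + n)`. -/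
theorem exists_norm_stieltjesRemainder_le (ℓ : ℕ) {a : ℂ} (ha : 1 ≤ a.re) :
    ∃ C : ℝ, 0 ≤ C ∧ ∀ m n : ℕ, 3 ≤ m + n → ∀ g : ℝ → ℝ, Continuous g →
      (∀ x ∈ Set.Ioc (0 : ℝ) 1, (x / (a.re + x)) ^ m * ((1 - x) / (a.re + x)) ^ n ≤ g x) →
      ‖stieltjesRemainder ℓ m n a‖ ≤
        C * (2 + Real.log ((m + n : ℕ) : ℝ)) ^ ℓ * ∫ x in (0 : ℝ)..1, g x := by
  set S : ℝ := ∑' k : ℕ, (((k : ℝ) + 1) ^ 2)⁻¹ with hS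
  have hS0 : 0 ≤ S := tsum_nonneg fun k => by positivity
  -- `(a.re + 1) ^ 2` turns the exponent `2 - N` of `norm_hurwitzZetaDeriv_le` into `-N`
  set K : ℝ := Real.exp Real.pi * (a.re + 1) ^ 2 * S with hK
  have hK0 : 0 ≤ K := by positivity
  refine ⟨(ℓ + 1) * (ℓ.factorial * K), by positivity, fun m n hmn g hg hgx => ?_⟩
  set N := m + n with hN
  set I : ℝ := ∫ x in (0 : ℝ)..1, g x with hI
  have hint : ∀ r : ℕ, ‖∫ x in (0 : ℝ)..1,
      (x : ℂ) ^ m * (1 - (x : ℂ)) ^ n * hurwitzZetaDeriv r (N + 1) (a + (x : ℂ))‖ ≤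
        r.factorial * K * I := by
    intro r
    rw [hI, ← intervalIntegral.integral_const_mul]
    refine intervalIntegral.norm_integral_le_of_norm_le zero_le_one
      (Filter.Eventually.of_forall fun x hx => ?_)
      ((continuous_const.mul hg).intervalIntegrable _ _)
    have hx0 : 0 ≤ x := hx.1.le
    have hx1 : 0 ≤ 1 - x := by linarith [hx.2]
    have hb : 0 < a.re + x := by linarith
    have hD := norm_hurwitzZetaDeriv_le (z := a + (x : ℂ)) (by simpa using by linarith) r hmn
    rw [Complex.add_re, Complex.ofReal_re] at hD
    have hsplit : ((a.re + x) ^ (N - 2))⁻¹ = (a.re + x) ^ 2 * ((a.re + x) ^ N)⁻¹ := by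
      obtain ⟨d, hd⟩ := Nat.exists_eq_add_of_le (show 2 ≤ N by omega)
      rw [hd, Nat.add_sub_cancel_left, pow_add]
      field_simp
    have hn1 : ‖(x : ℂ) ^ m * (1 - (x : ℂ)) ^ n‖ = x ^ m * (1 - x) ^ n := by
      rw [norm_mul, norm_pow, norm_pow, ← Complex.ofReal_one, ← Complex.ofReal_sub,
        Complex.norm_of_nonneg hx0, Complex.norm_of_nonneg hx1]
    rw [norm_mul, hn1]
    calc x ^ m * (1 - x) ^ n * ‖hurwitzZetaDeriv r (N + 1) (a + (x : ℂ))‖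
        ≤ x ^ m * (1 - x) ^ n * (r.factorial * (Real.exp Real.pi *
            ((a.re + x) ^ (N - 2))⁻¹ * S)) := by gcongr
      _ = r.factorial * (Real.exp Real.pi * (a.re + x) ^ 2 * S) *
            ((x / (a.re + x)) ^ m * ((1 - x) / (a.re + x)) ^ n) := by
          rw [hsplit, hN, pow_add (a.re + x) m n, div_pow, div_pow]
          field_simp
      _ ≤ r.factorial * K * g x := by
          rw [hK]
          gcongr
          · exact hx.2
          · exact hgx x hx
  have hfac : (0 : ℝ) < N.factorial := by exact_mod_cast N.factorial_pos
  have hI0 : 0 ≤ I := by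
    rw [hI, intervalIntegral.integral_of_le zero_le_one]
    refine MeasureTheory.setIntegral_nonneg measurableSet_Ioc fun x hx => le_trans ?_ (hgx x hx)
    have hx0 := hx.1
    have hx1 := hx.2
    have h3 : 0 ≤ (1 - x) / (a.re + x) := div_nonneg (by linarith) (by linarith)
    have h4 : 0 ≤ x / (a.re + x) := div_nonneg (by linarith) (by linarith)
    positivity
  set L : ℝ := (2 + Real.log (N : ℝ)) ^ ℓ with hL
  have hL0 : 0 ≤ L := pow_nonneg (by linarith [Real.log_natCast_nonneg N]) _
  rw [stieltjesRemainder, norm_mul, norm_div, norm_pow, norm_neg, norm_one, one_pow,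
    Complex.norm_natCast, ← hN]
  have hsum : ‖∑ k ∈ Finset.range (ℓ + 1), (stirlingS (N + 1) (k + 1) : ℂ) *
        ((ℓ.factorial : ℂ) / ((ℓ - k).factorial : ℂ)) * (-1) ^ k *
        ∫ x in (0 : ℝ)..1,
          (x : ℂ) ^ m * (1 - (x : ℂ)) ^ n * hurwitzZetaDeriv (ℓ - k) (N + 1) (a + (x : ℂ))‖ ≤
      ∑ _k ∈ Finset.range (ℓ + 1), N.factorial * L * (ℓ.factorial * K * I) := by
    refine norm_sum_le_of_le _ fun k hk => ?_
    have hs := norm_stirlingS_succ_succ_le (N := N)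
      (Nat.lt_succ_iff.mp (Finset.mem_range.mp hk))
    have hf : (0 : ℝ) < (ℓ - k).factorial := by exact_mod_cast (ℓ - k).factorial_pos
    rw [norm_mul, norm_mul, norm_mul, norm_pow, norm_neg, norm_one, one_pow, mul_one, norm_div,
      Complex.norm_natCast, Complex.norm_natCast]
    calc _ ≤ N.factorial * L * ((ℓ.factorial : ℝ) / (ℓ - k).factorial) *
          ((ℓ - k).factorial * K * I) := by
          gcongr
          exact hint _
      _ = _ := by field_simp
  calc _ ≤ 1 / (N.factorial : ℝ) *
        ∑ _k ∈ Finset.range (ℓ + 1), N.factorial * L * (ℓ.factorial * K * I) := by gcongr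
    _ = _ := by
      rw [Finset.sum_const, Finset.card_range, nsmul_eq_mul]
      push_cast
      field_simp

/-! ### Asymptotics -/

theorem tendsto_two_add_log_pow_div (ℓ n : ℕ) :
    Tendsto (fun m : ℕ => (2 + Real.log ((m + n : ℕ) : ℝ)) ^ ℓ / ((m : ℝ) + 1)) atTop (𝓝 0) := by
  -- `2 + log N = log (e² N)`
  have ht : Tendsto (fun m : ℕ => Real.exp 2 * ((m + n : ℕ) : ℝ)) atTop atTop :=
    (tendsto_natCast_atTop_atTop.comp (tendsto_add_atTop_nat n)).const_mul_atTop (Real.exp_pos 2)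
  have ho : (fun m : ℕ => Real.log (Real.exp 2 * ((m + n : ℕ) : ℝ)) ^ ℓ) =o[atTop]
      fun m : ℕ => Real.exp 2 * ((m + n : ℕ) : ℝ) :=
    (Real.isLittleO_pow_log_id_atTop (n := ℓ)).comp_tendsto ht
  have hO : (fun m : ℕ => Real.exp 2 * ((m + n : ℕ) : ℝ)) =O[atTop] fun m : ℕ => (m : ℝ) + 1 := by
    refine Asymptotics.IsBigO.of_bound (Real.exp 2 * (n + 1)) (Filter.Eventually.of_forall
      fun m => ?_)
    rw [Real.norm_of_nonneg (by positivity), Real.norm_of_nonneg (by positivity), mul_assoc]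
    gcongr
    push_cast
    nlinarith [mul_nonneg (Nat.cast_nonneg (α := ℝ) m) (Nat.cast_nonneg (α := ℝ) n)]
  refine (ho.trans_isBigO hO).tendsto_div_nhds_zero.congr' ?_
  filter_upwards [eventually_ge_atTop 1] with m hm
  rw [Real.log_mul (Real.exp_ne_zero 2) (by norm_cast; omega), Real.log_exp]

theorem limsup_rpow_one_div_le {u : ℕ → ℝ} (hu : ∀ m, 0 ≤ u m) {ρ : ℝ} (hρ : 0 < ρ)
    (h : ∀ᶠ m : ℕ in atTop, u m ≤ ((m : ℝ) + 1) * ρ ^ m) :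
    limsup (fun m : ℕ => ((u m ^ (1 / (m : ℝ)) : ℝ) : EReal)) atTop ≤ (ρ : EReal) := by
  refine EReal.le_of_forall_lt_iff_le.mp fun r hr => ?_
  have hr' : ρ < r := by exact_mod_cast hr
  have hr0 : 0 < r := hρ.trans hr'
  have ht : Tendsto (fun m : ℕ => (m : ℝ) * (ρ / r) ^ m + (ρ / r) ^ m) atTop (𝓝 (0 + 0)) :=
    (tendsto_self_mul_const_pow_of_lt_one (by positivity) ((div_lt_one hr0).mpr hr')).add
      (tendsto_pow_atTop_nhds_zero_of_lt_one (by positivity) ((div_lt_one hr0).mpr hr'))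
  rw [add_zero] at ht
  refine limsup_le_of_le (by isBoundedDefault) ?_
  filter_upwards [h, ht.eventually_le_const one_pos, eventually_ge_atTop 1] with m hm hm1 hm0
  have hle : u m ≤ r ^ m := by
    refine hm.trans ?_
    rw [div_pow, ← add_one_mul, mul_div_assoc', div_le_one (by positivity)] at hm1
    exact hm1
  have hm' : (m : ℝ) ≠ 0 := by norm_cast; omega
  refine EReal.coe_le_coe_iff.mpr ?_
  calc u m ^ (1 / (m : ℝ)) ≤ (r ^ m) ^ (1 / (m : ℝ)) := by
        gcongr
        exact hu m
    _ = r := by rw [← Real.rpow_natCast, ← Real.rpow_mul hr0.le, mul_one_div_cancel hm',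
        Real.rpow_one]

theorem eventually_norm_stieltjesRemainder_le (ℓ : ℕ) {a : ℂ} (ha : 1 ≤ a.re) (n : ℕ) :
    ∀ᶠ m : ℕ in atTop, ‖stieltjesRemainder ℓ m n a‖ ≤ ((m : ℝ) + 1) * (1 / (a.re + 1)) ^ m := by
  obtain ⟨C, hC, h⟩ := exists_norm_stieltjesRemainder_le ℓ ha
  have ht := (tendsto_two_add_log_pow_div ℓ n).const_mul C
  rw [mul_zero] at ht
  filter_upwards [ht.eventually_le_const one_pos, eventually_ge_atTop 3] with m hm hm3
  have hm1 : C * (2 + Real.log ((m + n : ℕ) : ℝ)) ^ ℓ ≤ (m : ℝ) + 1 := by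
    rwa [mul_div_assoc', div_le_one (by positivity)] at hm
  have hb := h m n (by omega) (fun _ => (1 / (a.re + 1)) ^ m) continuous_const fun x hx => by
    have hx0 := hx.1
    have hx1 := hx.2
    have h1 : x / (a.re + x) ≤ 1 / (a.re + 1) := by
      rw [div_le_div_iff₀ (by linarith) (by linarith)]
      nlinarith
    have h2 : (1 - x) / (a.re + x) ≤ 1 := by
      rw [div_le_one (by linarith)]; linarith
    have h3 : 0 ≤ (1 - x) / (a.re + x) := div_nonneg (by linarith) (by linarith)
    have h4 : 0 ≤ x / (a.re + x) := div_nonneg (by linarith) (by linarith)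
    calc _ ≤ (1 / (a.re + 1)) ^ m * 1 ^ n := by gcongr
      _ = _ := by rw [one_pow, mul_one]
  rw [intervalIntegral.integral_const, sub_zero, one_smul] at hb
  exact hb.trans (by gcongr)

/-- The factor `1 / (n + 1) = ∫ (1 - x) ^ n` absorbs the power of the logarithm; for `Re a = 1` it
is all the decay there is. -/
theorem exists_tendsto_zero_norm_stieltjesRemainder_le (ℓ : ℕ) {a : ℂ} (ha : 1 ≤ a.re) (m : ℕ) :
    ∃ ε : ℕ → ℝ, Tendsto ε atTop (𝓝 0) ∧
      ∀ᶠ n : ℕ in atTop, ‖stieltjesRemainder ℓ m n a‖ ≤ ε n * (1 / a.re) ^ n := by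
  obtain ⟨C, hC, h⟩ := exists_norm_stieltjesRemainder_le ℓ ha
  have ht := (tendsto_two_add_log_pow_div ℓ m).const_mul C
  rw [mul_zero] at ht
  refine ⟨_, ht, ?_⟩
  filter_upwards [eventually_ge_atTop 3] with n hn
  have hb := h m n (by omega) (fun x => (1 / a.re) ^ n * (1 - x) ^ n) (by fun_prop)
      fun x hx => by
    have hx0 := hx.1
    have hx1 := hx.2
    have h1 : x / (a.re + x) ≤ 1 := by
      rw [div_le_one (by linarith)]; linarith
    have h2 : (1 - x) / (a.re + x) ≤ 1 / a.re * (1 - x) := by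
      rw [div_eq_mul_one_div, mul_comm]
      have : 0 ≤ 1 - x := by linarith
      gcongr
      linarith
    have h3 : 0 ≤ (1 - x) / (a.re + x) := div_nonneg (by linarith) (by linarith)
    have h4 : 0 ≤ x / (a.re + x) := div_nonneg (by linarith) (by linarith)
    calc _ ≤ 1 ^ m * (1 / a.re * (1 - x)) ^ n := by gcongr
      _ = _ := by rw [one_pow, one_mul, mul_pow]
  have hi : ∫ x in (0 : ℝ)..1, (1 / a.re) ^ n * (1 - x) ^ n = (1 / a.re) ^ n * (1 / (n + 1)) := by
    rw [intervalIntegral.integral_const_mul,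
      intervalIntegral.integral_comp_sub_left (fun x : ℝ => x ^ n) 1]
    simp
  rw [hi, add_comm m n] at hb
  exact hb.trans (le_of_eq (by ring))

theorem theorem3 (ℓ : ℕ) (a : ℂ) (ha : 1 ≤ a.re) :
    (∀ n : ℕ, Tendsto (fun m : ℕ => stieltjesRemainder ℓ m n a) atTop (𝓝 0)) ∧
    (∀ m : ℕ, Tendsto (fun n : ℕ => stieltjesRemainder ℓ m n a) atTop (𝓝 0)) ∧
    (∀ n : ℕ,
      limsup (fun m : ℕ => ((‖stieltjesRemainder ℓ m n a‖ ^ (1 / (m : ℝ)) : ℝ) : EReal)) atTop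
        ≤ ((1 / (a.re + 1) : ℝ) : EReal)) ∧
    (1 < a.re → ∀ m : ℕ,
      limsup (fun n : ℕ => ((‖stieltjesRemainder ℓ m n a‖ ^ (1 / (n : ℝ)) : ℝ) : EReal)) atTop
        ≤ ((1 / a.re : ℝ) : EReal)) := by
  have ha0 : 0 < a.re := by linarith
  refine ⟨fun n => ?_, fun m => ?_, fun n => ?_, fun _ m => ?_⟩
  · have h0 : 0 ≤ 1 / (a.re + 1) := by positivity
    have h1 : 1 / (a.re + 1) < 1 := by rw [div_lt_one (by linarith)]; linarith
    have ht := (tendsto_self_mul_const_pow_of_lt_one h0 h1).add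
      (tendsto_pow_atTop_nhds_zero_of_lt_one h0 h1)
    rw [add_zero] at ht
    refine squeeze_zero_norm' ?_ ht
    filter_upwards [eventually_norm_stieltjesRemainder_le ℓ ha n] with m hm
    rwa [← add_one_mul]
  · obtain ⟨ε, hε, h⟩ := exists_tendsto_zero_norm_stieltjesRemainder_le ℓ ha m
    refine squeeze_zero_norm' ?_ (by simpa using hε.abs)
    filter_upwards [h] with n hn
    have h0 : 0 ≤ 1 / a.re := by positivity
    calc _ ≤ ε n * (1 / a.re) ^ n := hn
      _ ≤ |ε n| * 1 := by
        gcongr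
        · exact le_abs_self _
        · exact pow_le_one₀ h0 ((div_le_one ha0).mpr ha)
      _ = |ε n| := mul_one _
  · exact limsup_rpow_one_div_le (fun _ => norm_nonneg _) (by positivity)
      (eventually_norm_stieltjesRemainder_le ℓ ha n)
  · obtain ⟨ε, hε, h⟩ := exists_tendsto_zero_norm_stieltjesRemainder_le ℓ ha m
    refine limsup_rpow_one_div_le (fun _ => norm_nonneg _) (by positivity) ?_
    filter_upwards [h, hε.eventually_le_const one_pos] with n hn hn1
    refine hn.trans ?_
    gcongr
    linarith [Nat.cast_nonneg (α := ℝ) n]
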